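/- For $f\in L^2(\mathbb R)=L^2(\mathbb R;\mathbb C)$ let $$\mathcal V f(x,\omega)=\int_{\mathbb R}e^{-2\pi i t\omega}f(t)\,\overline{\varphi(x-t)}\,dt,\qquad \varphi(x)=2^{1/4}e^{-\pi x^2},$$ be the short-time Fourier transform with Gaussian window, and for $z_0=x_0+i\omega_0\in\mathbb C$ let $\varphi_{z_0}(x)=e^{2\pi i\omega_0x}\varphi(x-x_0)$. Identify $\mathbb R^2$ with $\mathbb C$. For a measurable set $\Omega\subset\mathbb C$ with Lebesgue measure $0<|\Omega|<\infty$ and $f\in L^2(\mathbb R)\setminus\{0\}$ define the deficit, the Fraenkel asymmetry and the distance to the optimizers by $$\delta(f;\Omega)=1-\frac{\int_\Omega|\mathcal Vf(x,\omega)|^2\,dx\,d\omega}{(1-e^{-|\Omega|})\|f\|_2^2},\qquad \mathcal A(\Omega)=\inf\Big\{\frac{|\Omega\triangle B(x,r)|}{|\Omega|}: |B(x,r)|=|\Omega|,\ r>0,\ x\in\mathbb C\Big\},$$ $$d(f)=\inf_{z_0\in\mathbb C,\ |c|=\|f\|_2}\frac{\|f-c\,\varphi_{z_0}\|_2}{\|f\|_2}.$$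 The stability estimates for the Faber–Krahn inequality for the short-time Fourier transform are $d(f)\le C\,(e^{|\Omega|}\delta(f;\Omega))^{1/2}$, with a universal constant $C$, and $\mathcal A(\Omega)\le K(|\Omega|)\,\delta(f;\Omega)^{1/2}$, with a constant $K(|\Omega|)$ depending only on $|\Omega|$. They are sharp in the following sense. 1. The factor $\delta(f;\Omega)^{1/2}$ cannot be replaced by $\delta(f;\Omega)^\beta$ with $\beta>1/2$ in either estimate, even among sets of a fixed measure. That is, for every $\beta>1/2$ and every $s>0$: (a) there is no constant $C$ such that $d(f)\le C\,e^{|\Omega|/2}\,\delta(f;\Omega)^{\beta}$ for all measurable $\Omega\subset\mathbb C$ with $|\Omega|=s$ and all $f\in L^2(\mathbb R)\setminus\{0\}$; (b) there is no constant $K$ such that $\mathcal A(\Omega)\le K\,\delta(f;\Omega)^{\beta}$ for all measurable $\Omega\subset\mathbb C$ with $|\Omega|=s$ and all $f\in L^2(\mathbb R)\setminus\{0\}$. 2. The factor $e^{|\Omega|/2}$ in the first estimate cannot be replaced by $e^{c|\Omega|/2}$ with $c<1$. That is, for every real $c<1$ there is no constant $C$ such that $$d(f)\le C\,\big(e^{c|\Omega|}\,\delta(f;\Omega)\big)^{1/2}$$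 for all measurable $\Omega\subset\mathbb C$ with $0<|\Omega|<\infty$ and all $f\in L^2(\mathbb R)\setminus\{0\}$. -/

import Mathlib

open MeasureTheory

noncomputable section

/-- The short-time Fourier transform
`V_g f (x, ω) = ∫ e^{-2π i t ω} f(t) conj (g (x - t)) dt` of `f` with window `g`. -/
def stft (g f : ℝ → ℂ) (x ω : ℝ) : ℂ :=
  ∫ t : ℝ, Complex.exp (-(2 * Real.pi * t * ω : ℝ) * Complex.I) * f t * star (g (x - t))

/-- The Gaussian window `φ(x) = 2^{1/4} e^{-π x²}`. -/
def gaussianWindow (x : ℝ) : ℂ :=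
  (((2 : ℝ) ^ (1 / 4 : ℝ) * Real.exp (-Real.pi * x ^ 2) : ℝ) : ℂ)

/-- The time-frequency shift `φ_{z₀}(x) = e^{2π i ω₀ x} φ(x - x₀)` of the Gaussian window, with
`z₀ = x₀ + i ω₀`. -/
def shiftedGaussian (z₀ : ℂ) (x : ℝ) : ℂ :=
  Complex.exp ((2 * Real.pi * z₀.im * x : ℝ) * Complex.I) * gaussianWindow (x - z₀.re)

theorem memLp_shiftedGaussian (z₀ : ℂ) : MemLp (shiftedGaussian z₀) 2 (volume : Measure ℝ) := by
  have hc : Continuous (shiftedGaussian z₀) := by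
    unfold shiftedGaussian gaussianWindow
    fun_prop
  rw [memLp_two_iff_integrable_sq_norm hc.aestronglyMeasurable]
  have h1 : Integrable (fun x : ℝ => Real.exp (-(2 * Real.pi) * x ^ 2)) :=
    integrable_exp_neg_mul_sq (by positivity)
  have h2 := (h1.comp_sub_right z₀.re).const_mul (((2 : ℝ) ^ (1 / 4 : ℝ)) ^ 2)
  refine h2.congr (Filter.Eventually.of_forall fun x => ?_)
  simp only [shiftedGaussian, gaussianWindow, norm_mul, Complex.norm_exp_ofReal_mul_I, one_mul,
    Complex.norm_real, Real.norm_eq_abs, Real.abs_exp, mul_pow, sq_abs]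
  rw [← Real.exp_nat_mul]
  congr 2
  push_cast
  ring

/-- `φ_{z₀}` as an element of `L²(ℝ)`. -/
def shiftedGaussianL2 (z₀ : ℂ) : Lp ℂ 2 (volume : Measure ℝ) :=
  (memLp_shiftedGaussian z₀).toLp (shiftedGaussian z₀)

/-- The combined deficit
`δ(f; Ω) = 1 - (∫_Ω |𝒱f(x, ω)|² dx dω) / ((1 - e^{-|Ω|}) ‖f‖²)`, where `𝒱` is the short-time Fourier
transform with the Gaussian window; the time-frequency plane is identified with `ℂ` through
`(x, ω) ↦ x + i ω`. -/
def deficit (f : Lp ℂ 2 (volume : Measure ℝ)) (Ω : Set ℂ) : ℝ :=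
  1 - (∫ z in Ω, ‖stft gaussianWindow f z.re z.im‖ ^ 2) /
    ((1 - Real.exp (-volume.real Ω)) * ‖f‖ ^ 2)

/-- The Fraenkel asymmetry: the infimum of `|Ω ∆ B| / |Ω|` over the discs `B` with `|B| = |Ω|`. -/
def fraenkelAsymmetry (Ω : Set ℂ) : ℝ :=
  sInf {a : ℝ | ∃ (x : ℂ) (r : ℝ), 0 < r ∧ volume (Metric.ball x r) = volume Ω ∧
    a = volume.real (symmDiff Ω (Metric.ball x r)) / volume.real Ω}

/-- The relative `L²`-distance of `f` to the optimizers of the same norm: the infimum of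
`‖f - c φ_{z₀}‖ / ‖f‖` over `z₀ ∈ ℂ` and `c ∈ ℂ` with `|c| = ‖f‖`. -/
def gaussianDistance (f : Lp ℂ 2 (volume : Measure ℝ)) : ℝ :=
  sInf {a : ℝ | ∃ z₀ c : ℂ, ‖c‖ = ‖f‖ ∧ a = ‖f - c • shiftedGaussianL2 z₀‖ / ‖f‖}

end

/-!
Each of the three estimates is refuted by a one-parameter family of examples.

*The distance to the optimizers.* On a centred disc `Ω` of area `s` take
`f = (1 + η (4πt² - 1)) φ`, the Gaussian perturbed by the second Hermite function. The first Hermite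
function would not do: it is tangent to the family of optimizers. Here `‖f‖² = 1 + 2η²`, and up to a
phase `𝒱f(z) = (1 + ηπ z̄²) exp (-π|z|²/2)` (`norm_stft_perturbedGaussianL2`). For `η ≤ 1/2` this has
modulus at most `1`, since `1 + ηπ|z|² ≤ exp (π|z|²/2)`. As `𝒱f(z) = ⟪φ_z, f⟫`, the function `f` stays
at distance at least `η` from the optimizers (`le_gaussianDistance_perturbedGaussianL2`). In the
integral of `|𝒱f|²` over the disc the cross term, a multiple of `Re z²`, vanishes by a quarter turn,
and the radial terms give
`δ(f; Ω) = η² e^{-s} (s² + 2s) / ((1 - e^{-s}) (1 + 2η²))`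
(`deficit_perturbedGaussianL2_centredDisc`). Letting `η → 0` with `s` fixed excludes exponents
`β > 1/2`; letting `s → ∞` with `η = 1/2` excludes factors `e^{c|Ω|/2}` with `c < 1`.

*The asymmetry.* Take `f = φ`, and let `Ω` be the centred disc of area `s` with its outermost area `ε`
replaced by the surrounding annulus of area `ε`. The deficit is `e^{-s} (e^ε + e^{-ε} - 2) / (1 - e^{-s})`,
of order `ε²` (`deficit_gaussian_perturbedDisc`). The asymmetry is of order `ε`
(`le_fraenkelAsymmetry_perturbedDisc`): as `Ω` is symmetric about the origin, no disc approximates it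
better, up to a factor `3`, than the centred one (`volume_real_symmDiff_ball_zero_le`).
-/

/-! ### The trial functions and their norm -/

theorem continuous_gaussianWindow : Continuous gaussianWindow := by
  unfold gaussianWindow
  fun_prop

theorem norm_gaussianWindow_sq (t : ℝ) :
    ‖gaussianWindow t‖ ^ 2 = √2 * Real.exp (-(2 * Real.pi) * t ^ 2) := by
  have h : ((2 : ℝ) ^ (1 / 4 : ℝ)) ^ 2 = √2 := by
    rw [Real.sqrt_eq_rpow, ← Real.rpow_natCast, ← Real.rpow_mul (by norm_num)]
    norm_num
  rw [gaussianWindow, Complex.norm_real, Real.norm_eq_abs, sq_abs, mul_pow, h, ← Real.exp_nat_mul]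
  congr 2
  push_cast
  ring

theorem integrable_pow_mul_exp_neg_mul_sq {b : ℝ} (hb : 0 < b) (n : ℕ) :
    Integrable (fun t : ℝ => t ^ n * Real.exp (-b * t ^ 2)) := by
  have h := integrable_rpow_mul_exp_neg_mul_sq hb (s := n)
    (by have := n.cast_nonneg (α := ℝ); linarith)
  simpa only [Real.rpow_natCast] using h

theorem memLp_pow_mul_gaussianWindow (n : ℕ) :
    MemLp (fun t : ℝ => (t : ℂ) ^ n * gaussianWindow t) 2 := by
  have hc : Continuous fun t : ℝ => (t : ℂ) ^ n * gaussianWindow t := by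
    have := continuous_gaussianWindow
    fun_prop
  rw [memLp_two_iff_integrable_sq_norm hc.aestronglyMeasurable]
  refine ((integrable_pow_mul_exp_neg_mul_sq (b := 2 * Real.pi) (by positivity)
    (2 * n)).const_mul √2).congr (Filter.Eventually.of_forall fun t => ?_)
  simp only [norm_mul, mul_pow, norm_gaussianWindow_sq, norm_pow, Complex.norm_real,
    Real.norm_eq_abs]
  rw [← pow_mul, mul_comm n 2, pow_mul |t|, sq_abs, ← pow_mul]
  ring

/-- The Gaussian perturbed by a multiple of the second Hermite function `(4πt² - 1) φ(t)`. -/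
noncomputable def perturbedGaussian (η t : ℝ) : ℂ :=
  ((1 + η * (4 * Real.pi * t ^ 2 - 1) : ℝ) : ℂ) * gaussianWindow t

theorem memLp_perturbedGaussian (η : ℝ) : MemLp (perturbedGaussian η) 2 := by
  have h := ((memLp_pow_mul_gaussianWindow 0).const_mul (1 - η : ℂ)).add
    ((memLp_pow_mul_gaussianWindow 2).const_mul (4 * Real.pi * η : ℂ))
  refine (memLp_congr_ae (Filter.Eventually.of_forall fun t => ?_)).mpr h
  simp only [perturbedGaussian, Pi.add_apply]
  push_cast
  ring

/-- `perturbedGaussian η` as an element of `L²(ℝ)`. -/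
noncomputable def perturbedGaussianL2 (η : ℝ) : Lp ℂ 2 (volume : Measure ℝ) :=
  (memLp_perturbedGaussian η).toLp (perturbedGaussian η)

theorem norm_toLp_sq {f : ℝ → ℂ} (hf : MemLp f 2) :
    ‖hf.toLp f‖ ^ 2 = ∫ t, ‖f t‖ ^ 2 := by
  rw [← inner_self_eq_norm_sq (𝕜 := ℂ), L2.inner_def]
  have h : ∫ t, inner ℂ (hf.toLp f t) (hf.toLp f t) = ((∫ t, ‖f t‖ ^ 2 : ℝ) : ℂ) := by
    rw [← integral_complex_ofReal]
    refine integral_congr_ae ?_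
    filter_upwards [hf.coeFn_toLp] with t ht
    rw [ht, inner_self_eq_norm_sq_to_K]
    push_cast
    rfl
  rw [h]
  exact Complex.ofReal_re _

theorem sqrt_two_mul_integral_exp : √2 * ∫ t : ℝ, Real.exp (-(2 * Real.pi) * t ^ 2) = 1 := by
  rw [integral_gaussian, ← Real.sqrt_mul (by norm_num)]
  have : 2 * (Real.pi / (2 * Real.pi)) = 1 := by field_simp
  rw [this, Real.sqrt_one]

theorem norm_perturbedGaussianL2_sq (η : ℝ) : ‖perturbedGaussianL2 η‖ ^ 2 = 1 + 2 * η ^ 2 := by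
  rw [perturbedGaussianL2, norm_toLp_sq]
  -- The square of the trial function differs from `(1 + 2η²) √2 exp (-2πt²)` by `√2 F'`.
  let F : ℝ → ℝ := fun t =>
    -((2 * η + η ^ 2) * t + 4 * Real.pi * η ^ 2 * t ^ 3) * Real.exp (-(2 * Real.pi) * t ^ 2)
  let F' : ℝ → ℝ := fun t =>
    ((1 + η * (4 * Real.pi * t ^ 2 - 1)) ^ 2 - (1 + 2 * η ^ 2)) *
      Real.exp (-(2 * Real.pi) * t ^ 2)
  have hd : ∀ t, HasDerivAt F (F' t) t := fun t => by
    have h1 : HasDerivAt (fun t : ℝ => Real.exp (-(2 * Real.pi) * t ^ 2))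
        (Real.exp (-(2 * Real.pi) * t ^ 2) * (-(2 * Real.pi) * (2 * t))) t := by
      have := ((hasDerivAt_pow 2 t).const_mul (-(2 * Real.pi))).exp
      simpa using this
    have h2 := (((hasDerivAt_id' t).const_mul (2 * η + η ^ 2)).fun_add
      ((hasDerivAt_pow 3 t).const_mul (4 * Real.pi * η ^ 2))).fun_neg
    refine (h2.mul h1).congr_deriv ?_
    simp only [F']
    push_cast
    ring
  have hi := fun n => integrable_pow_mul_exp_neg_mul_sq (b := 2 * Real.pi) (by positivity) n
  have hF : Integrable F := by
    refine (((hi 1).const_mul (-(2 * η + η ^ 2))).add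
      ((hi 3).const_mul (-(4 * Real.pi * η ^ 2)))).congr (Filter.Eventually.of_forall fun t => ?_)
    simp only [F, Pi.add_apply]
    ring
  have hF' : Integrable F' := by
    refine ((((hi 0).const_mul ((1 - η) ^ 2 - (1 + 2 * η ^ 2))).add
      ((hi 2).const_mul (8 * Real.pi * η * (1 - η)))).add
      ((hi 4).const_mul (16 * Real.pi ^ 2 * η ^ 2))).congr (Filter.Eventually.of_forall fun t => ?_)
    simp only [F', Pi.add_apply]
    ring
  have h0 := integral_eq_zero_of_hasDerivAt_of_integrable hd hF' hF
  have hg : Integrable fun t : ℝ => Real.exp (-(2 * Real.pi) * t ^ 2) := by simpa using hi 0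
  calc ∫ t, ‖perturbedGaussian η t‖ ^ 2
      = ∫ t, (√2 * F' t + ((1 + 2 * η ^ 2) * √2) * Real.exp (-(2 * Real.pi) * t ^ 2)) := by
        congr 1
        ext t
        simp only [F', perturbedGaussian, norm_mul, mul_pow, norm_gaussianWindow_sq,
          Complex.norm_real, Real.norm_eq_abs, sq_abs]
        ring
    _ = (1 + 2 * η ^ 2) * (√2 * ∫ t : ℝ, Real.exp (-(2 * Real.pi) * t ^ 2)) := by
        rw [integral_add (hF'.const_mul _) (hg.const_mul _), integral_const_mul,
          integral_const_mul, h0]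
        ring
    _ = 1 + 2 * η ^ 2 := by rw [sqrt_two_mul_integral_exp, mul_one]

theorem norm_shiftedGaussianL2 (z : ℂ) : ‖shiftedGaussianL2 z‖ = 1 := by
  have h : ‖shiftedGaussianL2 z‖ ^ 2 = 1 := by
    rw [shiftedGaussianL2, norm_toLp_sq]
    simp only [shiftedGaussian, norm_mul, Complex.norm_exp_ofReal_mul_I, one_mul,
      norm_gaussianWindow_sq]
    rw [integral_sub_right_eq_self (fun t : ℝ => √2 * Real.exp (-(2 * Real.pi) * t ^ 2)),
      integral_const_mul, sqrt_two_mul_integral_exp]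
  exact (pow_eq_one_iff_of_nonneg (norm_nonneg _) two_ne_zero).mp h

/-! ### The short-time Fourier transform of the trial functions -/

theorem stft_integrand_eq (f : ℝ → ℂ) (z : ℂ) (t : ℝ) :
    Complex.exp (-(2 * Real.pi * t * z.im : ℝ) * Complex.I) * f t *
      star (gaussianWindow (z.re - t)) = inner ℂ (shiftedGaussian z t) (f t) := by
  have h1 : star (gaussianWindow (z.re - t)) = star (gaussianWindow (t - z.re)) := by
    simp only [gaussianWindow]
    rw [← neg_sub t z.re, neg_sq]
  rw [h1, shiftedGaussian, RCLike.inner_apply, map_mul, ← Complex.exp_conj, map_mul,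
    Complex.conj_ofReal, Complex.conj_I, show 2 * Real.pi * z.im * t = 2 * Real.pi * t * z.im by ring,
    neg_mul, mul_neg]
  simp only [Complex.star_def]
  ring

/-- The short-time Fourier transform with Gaussian window is the inner product with the
time-frequency shifts of the Gaussian. -/
theorem stft_eq_inner (f : Lp ℂ 2 (volume : Measure ℝ)) (z : ℂ) :
    stft gaussianWindow f z.re z.im = inner ℂ (shiftedGaussianL2 z) f := by
  rw [L2.inner_def, stft]
  refine integral_congr_ae ?_
  filter_upwards [(memLp_shiftedGaussian z).coeFn_toLp] with t ht
  rw [stft_integrand_eq, shiftedGaussianL2, ht]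

theorem integrable_inner_shiftedGaussian {f : ℝ → ℂ} (hf : MemLp f 2) (z : ℂ) :
    Integrable fun t => inner ℂ (shiftedGaussian z t) (f t) := by
  have := (memLp_shiftedGaussian z).star.integrable_mul hf
  refine this.congr (Filter.Eventually.of_forall fun t => ?_)
  simp [RCLike.inner_apply, mul_comm]

/-- As a function of `t`, the integrand of the short-time Fourier transform of the Gaussian is a
complex Gaussian centred at `z̄ / 2`. -/
theorem inner_shiftedGaussian_gaussianWindow (z : ℂ) (t : ℝ) :
    inner ℂ (shiftedGaussian z t) (gaussianWindow t) = √2 *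
      Complex.exp (-(2 * Real.pi) * (t : ℂ) ^ 2 + 2 * Real.pi * star z * t + -Real.pi * z.re ^ 2) := by
  have h : (((2 : ℝ) ^ (1 / 4 : ℝ) : ℝ) : ℂ) * ((2 : ℝ) ^ (1 / 4 : ℝ) : ℝ) = (√2 : ℝ) := by
    rw [← Complex.ofReal_mul, ← Real.rpow_add (by norm_num), Real.sqrt_eq_rpow]
    norm_num
  rw [← stft_integrand_eq]
  have hz : star z = z.re - z.im * Complex.I := by
    apply Complex.ext <;> simp
  simp only [gaussianWindow, Complex.star_def, Complex.conj_ofReal]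
  rw [← Complex.star_def, hz, ← h]
  push_cast
  rw [show ∀ a b c d : ℂ, a * (b * c) * (b * d) = b * b * (a * c * d) by intros; ring,
    ← Complex.exp_add, ← Complex.exp_add]
  congr 2
  ring

theorem norm_integral_inner_gaussianWindow (z : ℂ) :
    ‖∫ t, inner ℂ (shiftedGaussian z t) (gaussianWindow t)‖ =
      Real.exp (-(Real.pi * ‖z‖ ^ 2) / 2) := by
  simp only [inner_shiftedGaussian_gaussianWindow]
  have hpi : (Real.pi : ℂ) ≠ 0 := by exact_mod_cast Real.pi_ne_zero
  rw [integral_const_mul, integral_cexp_quadratic (by simp [Real.pi_pos])]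
  have h1 : (Real.pi / -(-(2 * Real.pi)) : ℂ) = ((1 / 2 : ℝ) : ℂ) := by
    push_cast
    field_simp
  have h2 : ((1 / 2 : ℝ) : ℂ) ^ (1 / 2 : ℂ) = ((√(1 / 2) : ℝ) : ℂ) := by
    rw [Real.sqrt_eq_rpow, Complex.ofReal_cpow (by norm_num)]
    norm_num
  have h3 : -Real.pi * z.re ^ 2 - (2 * Real.pi * star z) ^ 2 / (4 * (-(2 * Real.pi) : ℂ)) =
      ((-Real.pi * z.re ^ 2 : ℝ) : ℂ) + ((Real.pi / 2 : ℝ) : ℂ) * (star z) ^ 2 := by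
    push_cast
    field_simp
    ring
  rw [h1, h2, h3, ← mul_assoc, ← Complex.ofReal_mul, ← Real.sqrt_mul (by norm_num), norm_mul,
    Complex.norm_real, Complex.norm_exp, Complex.add_re, Complex.ofReal_re, Complex.re_ofReal_mul,
    Complex.sq_norm, Complex.normSq_apply]
  norm_num [sq]
  ring

/-- On the perturbed Gaussian the short-time Fourier transform multiplies that of the Gaussian by
the polynomial `1 + ηπ z̄²`. -/
theorem integral_inner_perturbedGaussian (η : ℝ) (z : ℂ) :
    ∫ t, inner ℂ (shiftedGaussian z t) (perturbedGaussian η t) =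
      (1 + η * Real.pi * star z ^ 2) *
        ∫ t, inner ℂ (shiftedGaussian z t) (gaussianWindow t) := by
  set w : ℂ := star z with hw
  let g : ℝ → ℂ := fun t => inner ℂ (shiftedGaussian z t) (gaussianWindow t)
  have hinner : ∀ (c : ℂ) (t : ℝ),
      inner ℂ (shiftedGaussian z t) (c * gaussianWindow t) = c * g t := fun c t => by
    simp only [g, RCLike.inner_apply]
    ring
  have hpow : ∀ n : ℕ, Integrable fun t : ℝ => (t : ℂ) ^ n * g t := fun n => by
    simpa only [hinner] using
      integrable_inner_shiftedGaussian (memLp_pow_mul_gaussianWindow n) z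
  have hg : Integrable g := by simpa using hpow 0
  -- With `g' = (2πw - 4πt) g`, the derivative `F'` below is `(1 + πw² - 4πt²) g`.
  let F : ℝ → ℂ := fun t => (t + w / 2) * g t
  let F' : ℝ → ℂ := fun t => (1 + Real.pi * w ^ 2 - 4 * Real.pi * (t : ℂ) ^ 2) * g t
  have hd : ∀ t, HasDerivAt F (F' t) t := fun t => by
    have hid : HasDerivAt (fun t : ℝ => (t : ℂ)) 1 t := Complex.ofRealCLM.hasDerivAt
    have h1 : HasDerivAt g ((2 * Real.pi * w - 4 * Real.pi * t) * g t) t := by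
      have h2 := ((((hid.fun_pow 2).const_mul (-(2 * Real.pi) : ℂ)).fun_add
        (hid.const_mul (2 * Real.pi * w))).add_const (-Real.pi * z.re ^ 2 : ℂ)).cexp.const_mul
        ((√2 : ℝ) : ℂ)
      have hgeq : g = fun t : ℝ => ((√2 : ℝ) : ℂ) * Complex.exp (-(2 * Real.pi) * (t : ℂ) ^ 2 +
          2 * Real.pi * w * t + -Real.pi * z.re ^ 2) :=
        funext fun t => inner_shiftedGaussian_gaussianWindow z t
      rw [hgeq]
      refine h2.congr_deriv ?_
      push_cast
      ring
    refine ((hid.add_const (w / 2)).mul h1).congr_deriv ?_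
    simp only [F']
    ring
  have hF : Integrable F := by
    refine ((hpow 1).add (hg.const_mul (w / 2))).congr (Filter.Eventually.of_forall fun t => ?_)
    simp only [F, Pi.add_apply]
    ring
  have hF' : Integrable F' := by
    refine ((hg.const_mul (1 + Real.pi * w ^ 2)).sub
      ((hpow 2).const_mul (4 * Real.pi : ℂ))).congr (Filter.Eventually.of_forall fun t => ?_)
    simp only [F', Pi.sub_apply]
    ring
  have h0 := integral_eq_zero_of_hasDerivAt_of_integrable hd hF' hF
  calc ∫ t, inner ℂ (shiftedGaussian z t) (perturbedGaussian η t)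
      = ∫ t, ((1 + η * Real.pi * w ^ 2) * g t - η * F' t) := by
        congr 1
        ext t
        simp only [perturbedGaussian, hinner, F']
        push_cast
        ring
    _ = (1 + η * Real.pi * w ^ 2) * ∫ t, g t := by
        rw [integral_sub (hg.const_mul _) (hF'.const_mul _), integral_const_mul,
          integral_const_mul, h0, mul_zero, sub_zero]

theorem norm_stft_perturbedGaussianL2 (η : ℝ) (z : ℂ) :
    ‖stft gaussianWindow (perturbedGaussianL2 η) z.re z.im‖ =
      ‖1 + η * Real.pi * star z ^ 2‖ * Real.exp (-(Real.pi * ‖z‖ ^ 2) / 2) := by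
  rw [← norm_integral_inner_gaussianWindow, ← norm_mul, ← integral_inner_perturbedGaussian,
    stft_eq_inner, L2.inner_def]
  congr 1
  refine integral_congr_ae ?_
  filter_upwards [(memLp_shiftedGaussian z).coeFn_toLp,
    (memLp_perturbedGaussian η).coeFn_toLp] with t h1 h2
  rw [shiftedGaussianL2, perturbedGaussianL2, h1, h2]

theorem norm_stft_perturbedGaussianL2_sq (η : ℝ) (z : ℂ) :
    ‖stft gaussianWindow (perturbedGaussianL2 η) z.re z.im‖ ^ 2 =
      (1 + η ^ 2 * (Real.pi * ‖z‖ ^ 2) ^ 2) * Real.exp (-(Real.pi * ‖z‖ ^ 2)) +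
        2 * η * Real.pi * ((z ^ 2).re * Real.exp (-(Real.pi * ‖z‖ ^ 2))) := by
  rw [norm_stft_perturbedGaussianL2, mul_pow, ← Real.exp_nat_mul]
  have h : ‖1 + η * Real.pi * star z ^ 2‖ ^ 2 =
      1 + η ^ 2 * (Real.pi * ‖z‖ ^ 2) ^ 2 + 2 * η * Real.pi * (z ^ 2).re := by
    rw [Complex.sq_norm, Complex.sq_norm]
    simp only [Complex.normSq_apply, pow_two, Complex.star_def, Complex.add_re,
      Complex.add_im, Complex.mul_re, Complex.mul_im, Complex.conj_re, Complex.conj_im,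
      Complex.one_re, Complex.one_im, Complex.ofReal_re, Complex.ofReal_im]
    ring
  rw [h]
  push_cast
  ring_nf

/-- For a small perturbation the supremum of the short-time Fourier transform does not grow: the
polynomial factor is at most `1 + ηπ|z|² ≤ exp (π|z|²/2)`. -/
theorem norm_stft_perturbedGaussianL2_le_one {η : ℝ} (h0 : 0 ≤ η) (h1 : η ≤ 1 / 2) (z : ℂ) :
    ‖stft gaussianWindow (perturbedGaussianL2 η) z.re z.im‖ ≤ 1 := by
  rw [norm_stft_perturbedGaussianL2]
  have hp : 0 ≤ Real.pi * ‖z‖ ^ 2 := by positivity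
  have h2 : ‖1 + η * Real.pi * star z ^ 2‖ ≤ 1 + η * (Real.pi * ‖z‖ ^ 2) := by
    refine (norm_add_le _ _).trans_eq ?_
    rw [norm_mul, norm_mul, norm_pow, norm_star, norm_one, Complex.norm_real, Complex.norm_real,
      Real.norm_of_nonneg h0, Real.norm_of_nonneg Real.pi_pos.le, mul_assoc]
  have h3 : 1 + η * (Real.pi * ‖z‖ ^ 2) ≤ Real.exp (Real.pi * ‖z‖ ^ 2 / 2) := by
    have := Real.add_one_le_exp (Real.pi * ‖z‖ ^ 2 / 2)
    nlinarith
  calc _ ≤ Real.exp (Real.pi * ‖z‖ ^ 2 / 2) * Real.exp (-(Real.pi * ‖z‖ ^ 2) / 2) := by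
        gcongr
        exact h2.trans h3
    _ = 1 := by
        rw [← Real.exp_add]
        ring_nf
        exact Real.exp_zero

/-! ### The distance to the optimizers -/

/-- Expanding the square, `‖f - c φ_z‖² ≥ 2‖f‖² - 2‖f‖ |𝒱f(z)|` when `|c| = ‖f‖`, so an upper bound
for the short-time Fourier transform bounds the distance to the optimizers from below. -/
theorem le_gaussianDistance {f : Lp ℂ 2 (volume : Measure ℝ)} {M a : ℝ}
    (hM : ∀ z : ℂ, ‖stft gaussianWindow f z.re z.im‖ ≤ M)
    (ha : (a * ‖f‖) ^ 2 ≤ 2 * ‖f‖ ^ 2 - 2 * M * ‖f‖) (hf : f ≠ 0) :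
    a ≤ gaussianDistance f := by
  have hpos : 0 < ‖f‖ := norm_pos_iff.mpr hf
  refine le_csInf ⟨_, 0, ‖f‖, by simp, rfl⟩ ?_
  rintro _ ⟨z, c, hc, rfl⟩
  rw [le_div_iff₀ hpos]
  refine le_of_abs_le (abs_le_of_sq_le_sq ?_ (norm_nonneg _))
  have h1 : RCLike.re (inner ℂ f (c • shiftedGaussianL2 z)) ≤ ‖f‖ * M := by
    refine (RCLike.re_le_norm _).trans ?_
    rw [inner_smul_right, norm_mul, hc, norm_inner_symm, ← stft_eq_inner]
    exact mul_le_mul_of_nonneg_left (hM z) hpos.le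
  rw [@norm_sub_sq ℂ, norm_smul, norm_shiftedGaussianL2, hc]
  linarith

theorem perturbedGaussianL2_ne_zero (η : ℝ) : perturbedGaussianL2 η ≠ 0 := by
  intro h
  have := norm_perturbedGaussianL2_sq η
  rw [h, norm_zero] at this
  nlinarith [sq_nonneg η]

theorem le_gaussianDistance_perturbedGaussianL2 {η : ℝ} (h0 : 0 ≤ η) (h1 : η ≤ 1 / 2) :
    η ≤ gaussianDistance (perturbedGaussianL2 η) := by
  refine le_gaussianDistance (norm_stft_perturbedGaussianL2_le_one h0 h1) ?_
    (perturbedGaussianL2_ne_zero η)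
  have hN := norm_perturbedGaussianL2_sq η
  set N := ‖perturbedGaussianL2 η‖
  have hN0 : 0 ≤ N := norm_nonneg _
  -- With `N² = 1 + 2η²` the claim reads `η² N² ≤ 2 N² - 2 N`.
  have hη : η ^ 2 ≤ 1 / 4 := by nlinarith
  have hle : N ≤ 1 + η ^ 2 := by nlinarith [sq_nonneg (η ^ 2)]
  rw [mul_pow]
  nlinarith [sq_nonneg η]

/-! ### Integrals over centred discs -/

theorem Complex.volume_ball_eq_ofReal (a : ℂ) (r : ℝ) (hr : 0 ≤ r) :
    volume (Metric.ball a r) = ENNReal.ofReal (Real.pi * r ^ 2) := by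
  rw [Complex.volume_ball, mul_comm, ENNReal.ofReal_mul Real.pi_pos.le, ENNReal.ofReal_pow hr]
  congr 1
  exact (ENNReal.ofReal_coe_nnreal (p := NNReal.pi)).symm

theorem setIntegral_ball_comp_pi_mul_norm_sq {g : ℝ → ℝ} (hg : Continuous g) {r : ℝ}
    (hr : 0 ≤ r) :
    ∫ z in Metric.ball (0 : ℂ) r, g (Real.pi * ‖z‖ ^ 2) = ∫ t in (0)..(Real.pi * r ^ 2), g t := by
  let h : ℝ → ℝ := (Set.Iio r).indicator fun y => g (Real.pi * y ^ 2)
  have h1 : ∫ z in Metric.ball (0 : ℂ) r, g (Real.pi * ‖z‖ ^ 2) = ∫ z : ℂ, h ‖z‖ := by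
    rw [← integral_indicator measurableSet_ball]
    congr 1
    ext z
    simp [h, Set.indicator]
  have hv : volume.real (Metric.ball (0 : ℂ) 1) = Real.pi := by
    rw [measureReal_def, Complex.volume_ball_eq_ofReal _ _ zero_le_one,
      ENNReal.toReal_ofReal (by positivity)]
    ring
  have h2 : ∫ y in Set.Ioi (0 : ℝ), y * h y = ∫ y in (0)..r, y * g (Real.pi * y ^ 2) := by
    rw [intervalIntegral.integral_of_le hr, integral_Ioc_eq_integral_Ioo,
      ← integral_indicator measurableSet_Ioi, ← integral_indicator measurableSet_Ioo]
    congr 1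
    ext y
    by_cases h0 : 0 < y <;> by_cases h1 : y < r <;> simp [h, Set.indicator, h0, h1]
  have h3 := intervalIntegral.integral_comp_mul_deriv (a := 0) (b := r) (g := g)
    (f := fun y => Real.pi * y ^ 2) (f' := fun y => Real.pi * (2 * y))
    (fun y _ => by simpa using (hasDerivAt_pow 2 y).const_mul Real.pi) (by fun_prop) hg
  have h4 : Real.pi * (0 : ℝ) ^ 2 = 0 := by ring
  rw [h1, integral_fun_norm_addHaar, Complex.finrank_real_complex, hv]
  simp only [Nat.add_one_sub_one, pow_one, smul_eq_mul, nsmul_eq_mul]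
  rw [h2, ← h4, ← h3, h4, ← intervalIntegral.integral_const_mul,
    ← intervalIntegral.integral_const_mul]
  congr 1
  ext y
  simp only [Function.comp]
  push_cast
  ring

/-- The disc of area `t` (for `t ≥ 0`) centred at the origin. -/
noncomputable def centredDisc (t : ℝ) : Set ℂ := Metric.ball 0 √(t / Real.pi)

theorem pi_mul_sqrt_div_pi_sq {t : ℝ} (ht : 0 ≤ t) : Real.pi * √(t / Real.pi) ^ 2 = t := by
  rw [Real.sq_sqrt (by positivity)]
  field_simp

theorem measurableSet_centredDisc (t : ℝ) : MeasurableSet (centredDisc t) := measurableSet_ball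

theorem centredDisc_mono : Monotone centredDisc := fun _ _ h =>
  Metric.ball_subset_ball (Real.sqrt_le_sqrt (by have := Real.pi_pos; gcongr))

theorem volume_centredDisc {t : ℝ} (ht : 0 ≤ t) : volume (centredDisc t) = ENNReal.ofReal t := by
  rw [centredDisc, Complex.volume_ball_eq_ofReal _ _ (Real.sqrt_nonneg _),
    pi_mul_sqrt_div_pi_sq ht]

theorem volume_real_centredDisc {t : ℝ} (ht : 0 ≤ t) : volume.real (centredDisc t) = t := by
  rw [measureReal_def, volume_centredDisc ht, ENNReal.toReal_ofReal ht]

theorem integral_one_add_mul_sq_mul_exp_neg (a s : ℝ) :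
    ∫ t in (0)..s, (1 + a * t ^ 2) * Real.exp (-t) =
      1 - Real.exp (-s) + a * (2 - Real.exp (-s) * (s ^ 2 + 2 * s + 2)) := by
  rw [intervalIntegral.integral_eq_sub_of_hasDerivAt
    (f := fun t => (1 + a * (t ^ 2 + 2 * t + 2)) * -Real.exp (-t))]
  · simp only [neg_zero, Real.exp_zero]
    ring
  · intro t _
    have h1 := (hasDerivAt_id' t).fun_neg.exp.fun_neg
    have h2 := ((((hasDerivAt_pow 2 t).fun_add ((hasDerivAt_id' t).const_mul 2)).add_const
      2).const_mul a).const_add 1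
    refine (h2.mul h1).congr_deriv ?_
    push_cast
    ring
  · exact Continuous.intervalIntegrable (by fun_prop) _ _

theorem integrableOn_centredDisc {F : ℂ → ℝ} (hF : Continuous F) (t : ℝ) :
    IntegrableOn F (centredDisc t) :=
  (hF.continuousOn.integrableOn_compact (isCompact_closedBall 0 √(t / Real.pi))).mono_set
    Metric.ball_subset_closedBall

/-- The quarter turn about the origin changes the sign of `Re z²`. -/
theorem setIntegral_ball_re_sq_mul_radial (g : ℝ → ℝ) (r : ℝ) :
    ∫ z in Metric.ball (0 : ℂ) r, (z ^ 2).re * g ‖z‖ = 0 := by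
  let e : ℂ ≃ₗᵢ[ℝ] ℂ := rotation (Circle.exp (Real.pi / 2))
  have he : ∀ z, e z = Complex.I * z := fun z => by
    simp only [e, rotation_apply, Circle.coe_exp]
    push_cast
    rw [Complex.exp_pi_div_two_mul_I]
  have h := e.measurePreserving.setIntegral_preimage_emb e.toHomeomorph.measurableEmbedding
    (fun z => (z ^ 2).re * g ‖z‖) (Metric.ball 0 r)
  have hpre : e ⁻¹' Metric.ball 0 r = Metric.ball 0 r := by
    ext z
    simp
  have hsq : ∀ z, ((e z) ^ 2).re = -(z ^ 2).re := fun z => by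
    rw [he, mul_pow, Complex.I_sq, neg_one_mul, Complex.neg_re]
  simp only [hpre, hsq, LinearIsometryEquiv.norm_map, neg_mul, integral_neg] at h
  linarith

theorem setIntegral_centredDisc_stft_sq (η : ℝ) {s : ℝ} (hs : 0 ≤ s) :
    ∫ z in centredDisc s, ‖stft gaussianWindow (perturbedGaussianL2 η) z.re z.im‖ ^ 2 =
      1 - Real.exp (-s) + η ^ 2 * (2 - Real.exp (-s) * (s ^ 2 + 2 * s + 2)) := by
  simp only [norm_stft_perturbedGaussianL2_sq]
  rw [integral_add (integrableOn_centredDisc (by fun_prop) s)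
    (integrableOn_centredDisc (by fun_prop) s), integral_const_mul, centredDisc,
    setIntegral_ball_re_sq_mul_radial (fun y => Real.exp (-(Real.pi * y ^ 2))),
    setIntegral_ball_comp_pi_mul_norm_sq (g := fun t => (1 + η ^ 2 * t ^ 2) * Real.exp (-t))
      (by fun_prop) (Real.sqrt_nonneg _), pi_mul_sqrt_div_pi_sq hs,
    integral_one_add_mul_sq_mul_exp_neg]
  ring

theorem one_sub_exp_neg_pos {s : ℝ} (hs : 0 < s) : 0 < 1 - Real.exp (-s) := by
  simpa using hs

theorem deficit_perturbedGaussianL2_centredDisc (η : ℝ) {s : ℝ} (hs : 0 < s) :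
    deficit (perturbedGaussianL2 η) (centredDisc s) =
      η ^ 2 * (Real.exp (-s) * (s ^ 2 + 2 * s)) / ((1 - Real.exp (-s)) * (1 + 2 * η ^ 2)) := by
  have h1 := (one_sub_exp_neg_pos hs).ne'
  have h2 : 1 + 2 * η ^ 2 ≠ 0 := by positivity
  rw [deficit, setIntegral_centredDisc_stft_sq η hs.le, volume_real_centredDisc hs.le,
    norm_perturbedGaussianL2_sq]
  field_simp
  ring

/-! ### A perturbed disc -/

/-- The disc of area `s` with the outermost area `ε` replaced by the annulus of area `ε` that
surrounds the disc. -/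
noncomputable def perturbedDisc (s ε : ℝ) : Set ℂ :=
  centredDisc (s - ε) ∪ (centredDisc (s + ε) \ centredDisc s)

theorem measurableSet_perturbedDisc (s ε : ℝ) : MeasurableSet (perturbedDisc s ε) :=
  (measurableSet_centredDisc _).union
    ((measurableSet_centredDisc _).diff (measurableSet_centredDisc _))

theorem setIntegral_perturbedDisc {F : ℂ → ℝ} (hF : Continuous F) {s ε : ℝ} (hε : 0 ≤ ε) :
    ∫ z in perturbedDisc s ε, F z = (∫ z in centredDisc (s - ε), F z) +
      ((∫ z in centredDisc (s + ε), F z) - ∫ z in centredDisc s, F z) := by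
  have hint := integrableOn_centredDisc hF
  have hd : Disjoint (centredDisc (s - ε)) (centredDisc (s + ε) \ centredDisc s) :=
    Set.disjoint_sdiff_right.mono_left (centredDisc_mono (by linarith))
  rw [perturbedDisc, setIntegral_union hd
    ((measurableSet_centredDisc _).diff (measurableSet_centredDisc _)) (hint _)
    ((hint _).mono_set Set.sdiff_subset), setIntegral_sdiff (measurableSet_centredDisc _) (hint _)
    (centredDisc_mono (by linarith))]

theorem volume_perturbedDisc_lt_top (s ε : ℝ) : volume (perturbedDisc s ε) < ⊤ :=
  measure_union_lt_top measure_ball_lt_top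
    ((measure_mono Set.sdiff_subset).trans_lt measure_ball_lt_top)

theorem volume_real_perturbedDisc {s ε : ℝ} (hε : 0 ≤ ε) (hs : ε ≤ s) :
    volume.real (perturbedDisc s ε) = s := by
  have h := setIntegral_perturbedDisc (F := fun _ => 1) continuous_const (s := s) hε
  simp only [setIntegral_const, smul_eq_mul, mul_one] at h
  rw [h, volume_real_centredDisc (by linarith), volume_real_centredDisc (by linarith),
    volume_real_centredDisc (by linarith)]
  ring

theorem volume_perturbedDisc {s ε : ℝ} (hε : 0 ≤ ε) (hs : ε ≤ s) :
    volume (perturbedDisc s ε) = ENNReal.ofReal s := by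
  rw [← ofReal_measureReal (volume_perturbedDisc_lt_top s ε).ne, volume_real_perturbedDisc hε hs]

theorem continuous_norm_stft_perturbedGaussianL2_sq (η : ℝ) :
    Continuous fun z : ℂ => ‖stft gaussianWindow (perturbedGaussianL2 η) z.re z.im‖ ^ 2 := by
  simp only [norm_stft_perturbedGaussianL2_sq]
  fun_prop

theorem deficit_gaussian_perturbedDisc {s ε : ℝ} (hε : 0 ≤ ε) (hs : ε ≤ s) (hs0 : 0 < s) :
    deficit (perturbedGaussianL2 0) (perturbedDisc s ε) =
      Real.exp (-s) * (Real.exp ε + Real.exp (-ε) - 2) / (1 - Real.exp (-s)) := by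
  have h1 := (one_sub_exp_neg_pos hs0).ne'
  rw [deficit, setIntegral_perturbedDisc (continuous_norm_stft_perturbedGaussianL2_sq 0) hε,
    setIntegral_centredDisc_stft_sq 0 (by linarith),
    setIntegral_centredDisc_stft_sq 0 (by linarith),
    setIntegral_centredDisc_stft_sq 0 (by linarith), volume_real_perturbedDisc hε hs,
    norm_perturbedGaussianL2_sq, show -(s - ε) = -s + ε by ring,
    show -(s + ε) = -s + -ε by ring, Real.exp_add, Real.exp_add]
  field_simp
  ring

/-- A set that is symmetric about the origin is, up to a factor `3`, as close to the centred disc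
as to any other disc of the same radius: the discs with centres `x` and `-x` are equally close to
the set, and by convexity they meet inside the disc with centre `0`. -/
theorem volume_real_symmDiff_ball_zero_le {Ω : Set ℂ}
    (hfin : volume Ω ≠ ⊤) (hsymm : -Ω = Ω) (x : ℂ) (r : ℝ) :
    volume.real (symmDiff Ω (Metric.ball 0 r)) ≤ 3 * volume.real (symmDiff Ω (Metric.ball x r)) := by
  have hb : ∀ y : ℂ, volume (Metric.ball y r) ≠ ⊤ := fun y => measure_ball_lt_top.ne
  have hm : ∀ y : ℂ, MeasurableSet (Metric.ball y r) := fun y => measurableSet_ball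
  have hvol : ∀ y : ℂ, volume.real (Metric.ball y r) = volume.real (Metric.ball (0 : ℂ) r) :=
    fun y => by simp only [measureReal_def, Complex.volume_ball]
  have hsd : ∀ y w : ℂ, volume.real (symmDiff (Metric.ball y r) (Metric.ball w r)) =
      2 * (volume.real (Metric.ball (0 : ℂ) r) -
        volume.real (Metric.ball y r ∩ Metric.ball w r)) := fun y w => by
    have h1 := measureReal_inter_add_sdiff (μ := volume) (s := Metric.ball y r) (hm w) (hb y)
    have h2 := measureReal_inter_add_sdiff (μ := volume) (s := Metric.ball w r) (hm y) (hb w)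
    rw [Set.inter_comm] at h2
    rw [measureReal_symmDiff_eq (hm y) (hm w) (hb y) (hb w)]
    rw [hvol] at h1 h2
    linarith
  have hsub : Metric.ball x r ∩ Metric.ball (-x) r ⊆ Metric.ball x r ∩ Metric.ball 0 r := by
    rintro y ⟨h1, h2⟩
    refine ⟨h1, ?_⟩
    have := (convex_ball y r) (Metric.mem_ball_comm.mp h1) (Metric.mem_ball_comm.mp h2)
      (a := 1 / 2) (b := 1 / 2) (by norm_num) (by norm_num) (by norm_num)
    rw [Metric.mem_ball_comm]
    simpa using this
  have h0x : volume.real (symmDiff (Metric.ball x r) (Metric.ball 0 r)) ≤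
      volume.real (symmDiff (Metric.ball x r) (Metric.ball (-x) r)) := by
    rw [hsd, hsd]
    have := measureReal_mono (μ := volume) hsub
      ((measure_mono Set.inter_subset_left).trans_lt measure_ball_lt_top).ne
    linarith
  have hneg : volume.real (symmDiff Ω (Metric.ball (-x) r)) =
      volume.real (symmDiff Ω (Metric.ball x r)) := by
    have h1 : symmDiff Ω (Metric.ball (-x) r) = -symmDiff Ω (Metric.ball x r) := by
      have h2 : Metric.ball (-x) r = -Metric.ball x r := by
        ext y
        simp only [Metric.mem_ball, Set.mem_neg, dist_eq_norm]
        rw [← norm_neg]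
        congr! 2
        ring
      conv_lhs => rw [← hsymm, h2]
      rfl
    rw [h1, measureReal_def, Measure.measure_neg, measureReal_def]
  have t1 := measureReal_symmDiff_le (μ := volume) (s := Ω) (t := Metric.ball x r) (Metric.ball 0 r)
    hfin (hb x)
  have t2 := measureReal_symmDiff_le (μ := volume) (s := Metric.ball x r) (t := Ω)
    (Metric.ball (-x) r) (hb x) hfin
  rw [symmDiff_comm (Metric.ball x r) Ω, hneg] at t2
  linarith

theorem neg_centredDisc (t : ℝ) : -centredDisc t = centredDisc t := by
  ext z
  simp [centredDisc]

theorem neg_perturbedDisc (s ε : ℝ) : -perturbedDisc s ε = perturbedDisc s ε := by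
  have h : ∀ A B C : Set ℂ, -(A ∪ (B \ C)) = -A ∪ (-B \ -C) := fun _ _ _ => rfl
  rw [perturbedDisc, h, neg_centredDisc, neg_centredDisc, neg_centredDisc]

theorem le_fraenkelAsymmetry_perturbedDisc {s ε : ℝ} (hs0 : 0 < s) (hε : 0 ≤ ε) (hs : ε ≤ s) :
    ε / (3 * s) ≤ fraenkelAsymmetry (perturbedDisc s ε) := by
  refine le_csInf ⟨_, 0, √(s / Real.pi), Real.sqrt_pos.mpr (div_pos hs0 Real.pi_pos),
    (volume_centredDisc hs0.le).trans (volume_perturbedDisc hε hs).symm, rfl⟩ ?_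
  rintro _ ⟨x, r, hr, hv, rfl⟩
  have hr' : Metric.ball 0 r = centredDisc s := by
    rw [volume_perturbedDisc hε hs, Complex.volume_ball_eq_ofReal _ _ hr.le,
      ENNReal.ofReal_eq_ofReal_iff (by positivity) hs0.le] at hv
    rw [centredDisc, ← hv, mul_div_cancel_left₀ _ Real.pi_ne_zero, Real.sqrt_sq hr.le]
  have h1 := volume_real_symmDiff_ball_zero_le
    (volume_perturbedDisc_lt_top s ε).ne (neg_perturbedDisc s ε) x r
  have hsub : centredDisc s \ centredDisc (s - ε) ⊆
      symmDiff (perturbedDisc s ε) (centredDisc s) := by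
    rintro z ⟨hz1, hz2⟩
    refine Or.inr ⟨hz1, ?_⟩
    rintro (h | h)
    · exact hz2 h
    · exact h.2 hz1
  have h2 : ε ≤ volume.real (symmDiff (perturbedDisc s ε) (centredDisc s)) := by
    refine le_trans (le_of_eq ?_) (measureReal_mono hsub ?_)
    · rw [measureReal_sdiff (centredDisc_mono (by linarith)) (measurableSet_centredDisc _)
        measure_ball_lt_top.ne, volume_real_centredDisc (by linarith),
        volume_real_centredDisc (by linarith)]
      ring
    · exact measure_symmDiff_ne_top (volume_perturbedDisc_lt_top s ε).ne measure_ball_lt_top.ne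
  rw [hr'] at h1
  rw [volume_real_perturbedDisc hε hs, div_le_div_iff₀ (by positivity) hs0]
  nlinarith

/-! ### Rates of decay -/

/-- A bound of a quantity of order `ε` by a power `β > 1/2` of one of order `ε²` fails as `ε → 0`. -/
theorem not_forall_le_mul_rpow {A β M ε₀ : ℝ} (hA : 0 ≤ A) (hβ : 1 / 2 < β) (hε₀ : 0 < ε₀) :
    ¬ ∀ ε : ℝ, 0 < ε → ε ≤ ε₀ → ε ≤ M * (A * ε ^ 2) ^ β := by
  intro h
  have hlim : Filter.Tendsto (fun ε : ℝ => M * A ^ β * ε ^ (2 * β - 1)) (nhdsWithin 0 (Set.Ioi 0))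
      (nhds (M * A ^ β * 0 ^ (2 * β - 1))) :=
    ((Real.continuousAt_rpow_const 0 (2 * β - 1) (Or.inr (by linarith))).tendsto.mono_left
      nhdsWithin_le_nhds).const_mul _
  rw [Real.zero_rpow (by linarith), mul_zero] at hlim
  have hge : ∀ᶠ ε : ℝ in nhdsWithin 0 (Set.Ioi 0), 1 ≤ M * A ^ β * ε ^ (2 * β - 1) := by
    filter_upwards [Ioc_mem_nhdsGT hε₀] with ε hε
    have h1 := h ε hε.1 hε.2
    have h2 : (ε ^ 2) ^ β = ε ^ (2 * β - 1) * ε := by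
      rw [← Real.rpow_natCast, ← Real.rpow_mul hε.1.le]
      nth_rw 3 [← Real.rpow_one ε]
      rw [← Real.rpow_add hε.1]
      norm_num
    rw [Real.mul_rpow hA (sq_nonneg ε), h2] at h1
    have := hε.1
    nlinarith
  exact absurd (ge_of_tendsto hlim hge) (by norm_num)

/-! ### Bounds for the deficits -/

theorem deficit_perturbedGaussianL2_centredDisc_nonneg (η : ℝ) {s : ℝ} (hs : 0 < s) :
    0 ≤ deficit (perturbedGaussianL2 η) (centredDisc s) := by
  have := one_sub_exp_neg_pos hs
  rw [deficit_perturbedGaussianL2_centredDisc η hs]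
  positivity

theorem deficit_perturbedGaussianL2_centredDisc_le (η : ℝ) {s : ℝ} (hs : 0 < s) :
    deficit (perturbedGaussianL2 η) (centredDisc s) ≤
      Real.exp (-s) * (s ^ 2 + 2 * s) / (1 - Real.exp (-s)) * η ^ 2 := by
  have := one_sub_exp_neg_pos hs
  rw [deficit_perturbedGaussianL2_centredDisc η hs, div_mul_eq_mul_div, mul_comm (η ^ 2)]
  gcongr
  nlinarith [sq_nonneg η]

theorem deficit_gaussian_perturbedDisc_nonneg {s ε : ℝ} (hε : 0 ≤ ε) (hs : ε ≤ s) (hs0 : 0 < s) :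
    0 ≤ deficit (perturbedGaussianL2 0) (perturbedDisc s ε) := by
  rw [deficit_gaussian_perturbedDisc hε hs hs0]
  have h1 := Real.add_one_le_exp ε
  have h2 := Real.add_one_le_exp (-ε)
  exact div_nonneg (mul_nonneg (Real.exp_pos _).le (by linarith)) (one_sub_exp_neg_pos hs0).le

theorem deficit_gaussian_perturbedDisc_le {s ε : ℝ} (hε : 0 ≤ ε) (hs : ε ≤ s) (hs0 : 0 < s)
    (h1 : ε ≤ 1) :
    deficit (perturbedGaussianL2 0) (perturbedDisc s ε) ≤
      2 * Real.exp (-s) / (1 - Real.exp (-s)) * ε ^ 2 := by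
  have hpos := one_sub_exp_neg_pos hs0
  have hε' : |ε| ≤ 1 := by rwa [abs_of_nonneg hε]
  have h2 := (abs_le.mp (Real.abs_exp_sub_one_sub_id_le hε')).2
  have h3 := (abs_le.mp (Real.abs_exp_sub_one_sub_id_le (x := -ε) (by rwa [abs_neg]))).2
  rw [neg_sq] at h3
  have h4 : Real.exp ε + Real.exp (-ε) - 2 ≤ 2 * ε ^ 2 := by linarith
  calc _ = _ := deficit_gaussian_perturbedDisc hε hs hs0
    _ ≤ Real.exp (-s) * (2 * ε ^ 2) / (1 - Real.exp (-s)) := by gcongr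
    _ = _ := by ring

/-! ### Sharpness -/

theorem not_exists_gaussianDistance_le_deficit_rpow {β s : ℝ} (hβ : 1 / 2 < β) (hs : 0 < s) :
    ¬ ∃ C : ℝ, ∀ Ω : Set ℂ, MeasurableSet Ω → volume Ω = ENNReal.ofReal s →
      ∀ f : Lp ℂ 2 (volume : Measure ℝ), f ≠ 0 →
        gaussianDistance f ≤ C * (Real.exp (volume.real Ω / 2) * deficit f Ω ^ β) := by
  rintro ⟨C, hC⟩
  have hpos := one_sub_exp_neg_pos hs
  refine not_forall_le_mul_rpow (A := Real.exp (-s) * (s ^ 2 + 2 * s) / (1 - Real.exp (-s)))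
    (M := |C| * Real.exp (s / 2)) (by positivity) hβ one_half_pos fun η h0 h1 => ?_
  have h := hC _ (measurableSet_centredDisc s) (volume_centredDisc hs.le) _
    (perturbedGaussianL2_ne_zero η)
  rw [volume_real_centredDisc hs.le] at h
  have hd := deficit_perturbedGaussianL2_centredDisc_nonneg η hs
  calc η ≤ _ := le_gaussianDistance_perturbedGaussianL2 h0.le h1
    _ ≤ _ := h
    _ ≤ |C| * (Real.exp (s / 2) * _) := by
        gcongr
        · exact le_abs_self C
        · exact deficit_perturbedGaussianL2_centredDisc_le η hs
    _ = _ := (mul_assoc _ _ _).symm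

theorem not_exists_fraenkelAsymmetry_le_deficit_rpow {β s : ℝ} (hβ : 1 / 2 < β) (hs : 0 < s) :
    ¬ ∃ K : ℝ, ∀ Ω : Set ℂ, MeasurableSet Ω → volume Ω = ENNReal.ofReal s →
      ∀ f : Lp ℂ 2 (volume : Measure ℝ), f ≠ 0 →
        fraenkelAsymmetry Ω ≤ K * deficit f Ω ^ β := by
  rintro ⟨K, hK⟩
  have hpos := one_sub_exp_neg_pos hs
  refine not_forall_le_mul_rpow (A := 2 * Real.exp (-s) / (1 - Real.exp (-s)))
    (M := 3 * s * |K|) (by positivity) hβ (lt_min hs one_pos) fun ε h0 h1 => ?_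
  have hεs := h1.trans (min_le_left _ _)
  have h := (le_fraenkelAsymmetry_perturbedDisc hs h0.le hεs).trans
    (hK _ (measurableSet_perturbedDisc s ε) (volume_perturbedDisc h0.le hεs) _
      (perturbedGaussianL2_ne_zero 0))
  have hd := deficit_gaussian_perturbedDisc_nonneg h0.le hεs hs
  rw [div_le_iff₀' (by positivity)] at h
  calc ε ≤ _ := h
    _ ≤ 3 * s * (|K| * _) := by
        gcongr
        · exact le_abs_self K
        · exact deficit_gaussian_perturbedDisc_le h0.le hεs hs (h1.trans (min_le_right _ _))
    _ = _ := (mul_assoc _ _ _).symm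

theorem not_exists_gaussianDistance_le_exp_mul_deficit {c : ℝ} (hc : c < 1) :
    ¬ ∃ C : ℝ, ∀ Ω : Set ℂ, MeasurableSet Ω → 0 < volume Ω → volume Ω < ⊤ →
      ∀ f : Lp ℂ 2 (volume : Measure ℝ), f ≠ 0 →
        gaussianDistance f ≤
          C * (Real.exp (c * volume.real Ω) * deficit f Ω) ^ (1 / 2 : ℝ) := by
  rintro ⟨C, hC⟩
  -- The trial function with `η = 1 / 2` stays at a fixed distance from the optimizers, while its
  -- deficit on the disc of area `s` decays like `s² e^{-s}`.
  have hle : ∀ s : ℝ, 1 ≤ s → (1 / 2 : ℝ) ^ 2 ≤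
      C ^ 2 * (2 * (s ^ 2 * Real.exp (-((1 - c) * s)) + 2 * (s * Real.exp (-((1 - c) * s))))) := by
    intro s hs1
    have hs : 0 < s := one_pos.trans_le hs1
    have hpos := one_sub_exp_neg_pos hs
    have h := (le_gaussianDistance_perturbedGaussianL2 one_half_pos.le le_rfl).trans
      (hC _ (measurableSet_centredDisc s)
        (by rw [volume_centredDisc hs.le]; exact ENNReal.ofReal_pos.mpr hs)
        (by rw [volume_centredDisc hs.le]; exact ENNReal.ofReal_lt_top) _
        (perturbedGaussianL2_ne_zero (1 / 2)))
    rw [volume_real_centredDisc hs.le] at h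
    have hd := deficit_perturbedGaussianL2_centredDisc_nonneg (1 / 2) hs
    have hd' := deficit_perturbedGaussianL2_centredDisc_le (1 / 2) hs
    have hexp : Real.exp (-s) ≤ 1 / 2 := by
      rw [Real.exp_neg, one_div]
      gcongr
      have := Real.add_one_le_exp s
      linarith
    have hd2 : deficit (perturbedGaussianL2 (1 / 2)) (centredDisc s) ≤
        2 * (Real.exp (-s) * (s ^ 2 + 2 * s)) := by
      refine hd'.trans ?_
      rw [div_mul_eq_mul_div, div_le_iff₀ hpos]
      have : 0 ≤ Real.exp (-s) * (s ^ 2 + 2 * s) := by positivity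
      nlinarith
    have hsq := pow_le_pow_left₀ one_half_pos.le h 2
    rw [mul_pow, ← Real.sqrt_eq_rpow, Real.sq_sqrt (by positivity)] at hsq
    refine hsq.trans (mul_le_mul_of_nonneg_left ?_ (sq_nonneg C))
    calc _ ≤ Real.exp (c * s) * (2 * (Real.exp (-s) * (s ^ 2 + 2 * s))) := by gcongr
      _ = _ := by
        rw [show -((1 - c) * s) = c * s + -s by ring, Real.exp_add]
        ring
  have hlim : ∀ n : ℕ, Filter.Tendsto (fun s : ℝ => s ^ n * Real.exp (-((1 - c) * s)))
      Filter.atTop (nhds 0) := fun n => by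
    have h1 := (Real.tendsto_pow_mul_exp_neg_atTop_nhds_zero n).comp
      (Filter.tendsto_id.const_mul_atTop (sub_pos.mpr hc))
    have h2 := h1.const_mul (((1 - c) ^ n)⁻¹)
    rw [mul_zero] at h2
    refine h2.congr fun s => ?_
    have : (1 - c) ^ n ≠ 0 := pow_ne_zero _ (sub_pos.mpr hc).ne'
    simp only [Function.comp, id, mul_pow]
    field_simp
  have hlim1 := ((((hlim 2).add ((hlim 1).const_mul 2)).const_mul 2).const_mul (C ^ 2))
  simp only [pow_one, mul_zero, add_zero] at hlim1
  have := ge_of_tendsto hlim1 ((Filter.eventually_ge_atTop 1).mono hle)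
  norm_num at this

theorem mainTheorem5 :
    -- the exponent in the function estimate is optimal, already among sets of a fixed measure
    (∀ β : ℝ, 1 / 2 < β → ∀ s : ℝ, 0 < s →
      ¬ ∃ C : ℝ, ∀ Ω : Set ℂ, MeasurableSet Ω → volume Ω = ENNReal.ofReal s →
        ∀ f : Lp ℂ 2 (volume : Measure ℝ), f ≠ 0 →
          gaussianDistance f ≤ C * (Real.exp (volume.real Ω / 2) * deficit f Ω ^ β)) ∧
    -- the exponent in the set estimate is optimal, already among sets of a fixed measure
    (∀ β : ℝ, 1 / 2 < β → ∀ s : ℝ, 0 < s →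
      ¬ ∃ K : ℝ, ∀ Ω : Set ℂ, MeasurableSet Ω → volume Ω = ENNReal.ofReal s →
        ∀ f : Lp ℂ 2 (volume : Measure ℝ), f ≠ 0 →
          fraenkelAsymmetry Ω ≤ K * deficit f Ω ^ β) ∧
    -- the growth in the measure of the set in the function estimate is optimal
    (∀ c : ℝ, c < 1 →
      ¬ ∃ C : ℝ, ∀ Ω : Set ℂ, MeasurableSet Ω → 0 < volume Ω → volume Ω < ⊤ →
        ∀ f : Lp ℂ 2 (volume : Measure ℝ), f ≠ 0 →
          gaussianDistance f ≤
            C * (Real.exp (c * volume.real Ω) * deficit f Ω) ^ (1 / 2 : ℝ)) :=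
  ⟨fun _ hβ _ hs => not_exists_gaussianDistance_le_deficit_rpow hβ hs,
    fun _ hβ _ hs => not_exists_fraenkelAsymmetry_le_deficit_rpow hβ hs,
    fun _ hc => not_exists_gaussianDistance_le_exp_mul_deficit hc⟩
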